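/- Theorem 1.3 (low-card). Let $\mathbb L$ be a field of characteristic $0$ and let $H$ be an abstract group whose cardinality satisfies $|H| < |\mathbb L|$. Let $U$ be a unipotent linear algebraic group defined over $\mathbb L$ (that is, an affine algebraic group over $\mathbb L$ all of whose points over an algebraic closure $\overline{\mathbb L}$ are unipotent elements), and let $U(\mathbb L)$ be its group of $\mathbb L$-rational points. Then for every homomorphism of abstract groups $\phi : U(\mathbb L) \to H$, not assumed continuous or algebraic, the image $\phi(U(\mathbb L))$ is abelian. -/

import Mathlib

universe u v w

open scoped TensorProduct

/-!
A linear algebraic group `G` over a field `L` is given by its coordinate ring `A = L[G]`, a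
finitely generated commutative Hopf algebra over `L`.
-/

namespace LinearAlgebraicGroup

/-- The abstract group `G(k)` of `k`-rational points of the affine `k`-group `G` with coordinate
ring `A = k[G]`: the `k`-algebra homomorphisms `A → k`. `WithConv` is Mathlib's wrapper that makes
this set a group under convolution, `(x * y)(f) = ∑ x(f₁) y(f₂)` where `Δ f = ∑ f₁ ⊗ f₂`. -/
abbrev RationalPoints (k A : Type*) [Field k] [CommRing A] [HopfAlgebra k A] : Type _ :=
  WithConv (A →ₐ[k] k)

/-- Right translation by the point `g` on the coordinate ring `A = k[G]`:
`ρ(g) f = ∑ g(f₂) • f₁` where `Δ f = ∑ f₁ ⊗ f₂`, that is, `(ρ(g) f)(x) = f(x g)`. -/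
noncomputable def rightTranslation {k A : Type*} [Field k] [CommRing A] [HopfAlgebra k A]
    (g : RationalPoints k A) : A →ₗ[k] A :=
  (TensorProduct.rid k A).toLinearMap ∘ₗ
    TensorProduct.map LinearMap.id g.ofConv.toLinearMap ∘ₗ Coalgebra.comul

/-- A point `g` is a unipotent element of `G` if right translation by `g` on `k[G]` is locally
unipotent: every `f` is killed by a power of `ρ(g) - 1`. -/
def IsUnipotentElement {k A : Type*} [Field k] [CommRing A] [HopfAlgebra k A]
    (g : RationalPoints k A) : Prop :=
  ∀ f : A, ∃ n : ℕ, ((rightTranslation g - 1 : Module.End k A) ^ n) f = 0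

/-- The group `G` over `L` with coordinate ring `A = L[G]` is unipotent if all elements of
`G(L̄)`, where `L̄` is an algebraic closure of `L`, are unipotent elements of the base change of `G`
to `L̄`, whose coordinate ring is `L̄ ⊗ A`. -/
def IsUnipotent (L A : Type*) [Field L] [CommRing A] [HopfAlgebra L A] : Prop :=
  ∀ g : RationalPoints (AlgebraicClosure L) (AlgebraicClosure L ⊗[L] A), IsUnipotentElement g

end LinearAlgebraicGroup

/-!
A unipotent group over a field `L` of characteristic zero carries powers `x ^ s` with exponents
`s ∈ L`: the matrix entries of `x ^ m` are polynomials in the natural number `m`, and these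
polynomials may be evaluated at `s`. If `φ` maps the group of points `G` to a group with fewer
elements than `L`, then for each `x` two exponents `s ≠ t` satisfy `φ (x ^ s) = φ (x ^ t)`, so
`K = ker φ` contains `x ^ s` for some `s ≠ 0`. Suppose that the commutator `z = ⁅x, y⁆` is central.
Then `⁅x ^ s, y ^ t⁆ = z ^ (s * t)`, and choosing `s ≠ 0` with `x ^ s ∈ K` and letting `t` vary
gives `z ^ a ∈ K` for all `a ∈ L`. The theorem follows by applying this modulo larger and larger
normal subgroups contained in `K`.

The subgroups that are allowed here are those of the form `M = {g | log g ∈ W}`, with `W` a linear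
subspace of the ambient matrix algebra. They have two virtues. Since the naturals are Zariski dense
in `L`, a statement "`F s ∈ M`", with `F` depending polynomially on `s`, holds for all `s ∈ L` as
soon as it holds for natural `s`, where it is plain group theory in `G ⧸ M`
(`UnipotentRep.mem_of_natCast_mem`). And if moreover `F 0 = 1`, then the derivative of `F` at `0`
lies in `W` (`UnipotentRep.coeff_one_mem_of_natCast_mem`); applied to
`g ^ s * h ^ s * (g * h) ^ (-s)`, this shows that `log` is additive modulo `W` on elements that
commute modulo `M`, which replaces the Baker–Campbell–Hausdorff formula. Choose `M` normal in `G`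
and contained in `K` with `W` maximal. If `M` does not contain all commutators, nilpotency of `G`
gives a commutator `z ∉ M` that is central modulo `M`; then the subgroup generated by `M` and the
powers `z ^ a` is again of the allowed form, with subspace `W + L log z`, and it is contained in
`K`. This contradicts maximality (`UnipotentRep.commutator_le_of_exists_scalarPow_mem`).

Two facts about `G` are needed. It acts faithfully, by right translation, on a finite-dimensional
subspace of its coordinate ring that generates the coordinate ring, and the interpolated powers of
a point are again points because polynomial identities between functions of `m` persist at `s`
(`LinearAlgebraicGroup.exists_rationalPoint_interpolating_pow`). And it is nilpotent: the span of
the operators `g - 1` is an algebra whose elements all have trace zero, so in characteristic zero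
it consists of nilpotent operators, and Engel's theorem applies
(`exists_augmentationSpan_pow_eq_bot`).
-/

open Polynomial

/-! ### Polynomial functions with values in an algebra -/

section BinomialPolynomials

variable (L : Type*) [Field L]

/-- The binomial coefficient `X (X - 1) ⋯ (X - k + 1) / k!` as a polynomial over a field. -/
noncomputable def binomPoly (k : ℕ) : L[X] := C ((k.factorial : L)⁻¹) * descPochhammer L k

variable {L}

@[simp]
theorem binomPoly_zero : binomPoly L 0 = 1 := by simp [binomPoly]

@[simp]
theorem binomPoly_one : binomPoly L 1 = X := by simp [binomPoly]

variable [CharZero L]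

theorem eval_binomPoly_natCast (k m : ℕ) : (binomPoly L k).eval (m : L) = (m.choose k : L) := by
  have hk : (k.factorial : L) ≠ 0 := Nat.cast_ne_zero.mpr k.factorial_ne_zero
  rw [binomPoly, eval_mul, eval_C, descPochhammer_eval_eq_descFactorial,
    Nat.descFactorial_eq_factorial_mul_choose, Nat.cast_mul, inv_mul_cancel_left₀ hk]

theorem coeff_zero_binomPoly (k : ℕ) : (binomPoly L k).coeff 0 = if k = 0 then 1 else 0 := by
  rw [coeff_zero_eq_eval_zero, ← Nat.cast_zero, eval_binomPoly_natCast]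
  cases k <;> simp

theorem Polynomial.eq_of_eval_natCast_eq {p q : L[X]}
    (h : ∀ m : ℕ, p.eval (m : L) = q.eval (m : L)) : p = q :=
  Polynomial.eq_of_infinite_eval_eq p q
    ((Set.infinite_range_of_injective (Nat.cast_injective (R := L))).mono
      (by rintro _ ⟨m, rfl⟩; exact h m))

end BinomialPolynomials

section ScalarEvaluation

variable {L : Type*} [Field L] {R : Type*} [Ring R] [Algebra L R]

/-- Evaluation at a scalar `s`, as an algebra homomorphism on the polynomials over a possibly
noncommutative `L`-algebra `R`; it is multiplicative because scalars are central in `R`. -/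
noncomputable def evalAt (s : L) : R[X] →ₐ[L] R :=
  Polynomial.eval₂AlgHom (AlgHom.id L R) (algebraMap L R s) fun a => (Algebra.commutes s a).symm

@[simp]
theorem evalAt_C (s : L) (a : R) : evalAt s (C a) = a :=
  eval₂_C _ _

theorem evalAt_map (s : L) (p : L[X]) :
    evalAt s (p.map (algebraMap L R)) = algebraMap L R (p.eval s) := by
  change eval₂ (AlgHom.id L R : R →+* R) (algebraMap L R s) _ = _
  rw [eval₂_map]
  exact (Polynomial.hom_eval₂ p (RingHom.id L) (algebraMap L R) s).symm

theorem evalAt_eq_sum (s : L) (p : R[X]) :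
    evalAt s p = p.sum fun k a => s ^ k • a := by
  change eval₂ (AlgHom.id L R : R →+* R) (algebraMap L R s) p = _
  rw [eval₂_eq_sum]
  refine Finset.sum_congr rfl fun k _ => ?_
  change p.coeff k * algebraMap L R s ^ k = s ^ k • p.coeff k
  rw [Algebra.smul_def, ← map_pow, Algebra.commutes]

/-- A polynomial that takes values in a subspace at all natural numbers has all its coefficients in
that subspace: apply the linear functionals that vanish on the subspace. -/
theorem Submodule.coeff_mem_of_evalAt_natCast_mem [CharZero L] (W : Submodule L R) {p : R[X]}
    (h : ∀ m : ℕ, evalAt (m : L) p ∈ W) (k : ℕ) : p.coeff k ∈ W := by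
  by_contra hk
  obtain ⟨f, hf, hW⟩ := W.exists_le_ker_of_notMem hk
  apply hf
  let q : L[X] := p.sum fun i a => monomial i (f a)
  have hq : ∀ s : L, q.eval s = f (evalAt s p) := by
    intro s
    simp only [q, evalAt_eq_sum, Polynomial.sum, eval_finsetSum, eval_monomial, map_sum, map_smul,
      smul_eq_mul, mul_comm]
  have hq0 : q = 0 := by
    refine Polynomial.eq_of_eval_natCast_eq fun m => ?_
    rw [hq, eval_zero]
    exact hW (h m)
  have := congrArg (fun r => Polynomial.coeff r k) hq0
  simp only [q, Polynomial.sum, finsetSum_coeff, coeff_monomial, coeff_zero] at this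
  by_cases hks : k ∈ p.support
  · simpa [Finset.sum_ite_eq', hks] using this
  · simp [notMem_support_iff.mp hks]

theorem Submodule.evalAt_mem_of_coeff_mem (W : Submodule L R) {p : R[X]}
    (h : ∀ k, p.coeff k ∈ W) (s : L) : evalAt s p ∈ W := by
  rw [evalAt_eq_sum]
  exact W.sum_mem fun k _ => W.smul_mem _ (h k)

theorem eq_of_evalAt_natCast_eq [CharZero L] {p q : R[X]}
    (h : ∀ m : ℕ, evalAt (m : L) p = evalAt (m : L) q) : p = q := by
  ext k
  have := (⊥ : Submodule L R).coeff_mem_of_evalAt_natCast_mem (p := p - q)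
    (fun m => by rw [map_sub, h, sub_self]; exact Submodule.zero_mem _) k
  rwa [Submodule.mem_bot, coeff_sub, sub_eq_zero] at this

end ScalarEvaluation

section UnipotentPowers

variable {L : Type*} [Field L] {R : Type*} [Ring R] [Algebra L R]

/-- The power `u ^ s = ∑ₖ (s choose k) (u - 1) ^ k` with a scalar exponent `s`. The sum is truncated
at `k < N`, which loses nothing when `(u - 1) ^ N = 0`. -/
noncomputable def unipotentPow (N : ℕ) (u : R) (s : L) : R :=
  ∑ k ∈ Finset.range N, (binomPoly L k).eval s • (u - 1) ^ k

/-- The power of `u` with exponent the polynomial `a`, as a polynomial with coefficients in `R`. -/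
noncomputable def unipotentPowPoly (N : ℕ) (u : R) (a : L[X]) : R[X] :=
  ∑ k ∈ Finset.range N, C ((u - 1) ^ k) * (((binomPoly L k).comp a).map (algebraMap L R))

/-- The logarithm of `u`, that is, the coefficient of `s` in `u ^ s`; the coefficient of `X` in
`X choose k` is `(-1) ^ (k + 1) / k`. The sum is truncated at `k < N` as in `unipotentPow`. The
algebra `R` may itself be a polynomial ring, which makes sense of the logarithm of a polynomial. -/
noncomputable def unipotentLog (L : Type*) [Field L] {R : Type*} [Ring R] [Algebra L R]
    (N : ℕ) (u : R) : R :=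
  ∑ k ∈ Finset.range N, (binomPoly L k).coeff 1 • (u - 1) ^ k

theorem evalAt_unipotentPowPoly (N : ℕ) (u : R) (a : L[X]) (s : L) :
    evalAt s (unipotentPowPoly N u a) = unipotentPow N u (a.eval s) := by
  simp only [unipotentPowPoly, unipotentPow, map_sum, map_mul, evalAt_C, evalAt_map, eval_comp]
  exact Finset.sum_congr rfl fun k _ => by rw [Algebra.smul_def, Algebra.commutes]

/-- The binomial theorem for `u ^ m = (1 + (u - 1)) ^ m`, applied to a vector killed by a power of
`u - 1`. The number of terms does not depend on `m`. -/
theorem pow_smul_eq_sum_choose {M : Type*} [AddCommGroup M] [Module R M] {N : ℕ} {u : R} {v : M}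
    (hu : (u - 1) ^ N • v = 0) (m : ℕ) :
    u ^ m • v = ∑ k ∈ Finset.range N, m.choose k • (u - 1) ^ k • v := by
  have hz : ∀ k, N ≤ k → (u - 1) ^ k • v = 0 := fun k hk => by
    rw [← Nat.sub_add_cancel hk, pow_add, mul_smul, hu, smul_zero]
  have h1 : u ^ m • v = ∑ k ∈ Finset.range (m + 1), m.choose k • (u - 1) ^ k • v := by
    conv_lhs => rw [← sub_add_cancel u 1, (Commute.one_right (u - 1)).add_pow, Finset.sum_smul]
    refine Finset.sum_congr rfl fun k _ => ?_
    rw [one_pow, mul_one, ← Nat.cast_comm, ← nsmul_eq_mul, smul_assoc]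
  have h2 : ∀ A B : ℕ, A ≤ B → (∀ k, A ≤ k → m.choose k • (u - 1) ^ k • v = 0) →
      ∑ k ∈ Finset.range B, m.choose k • (u - 1) ^ k • v =
        ∑ k ∈ Finset.range A, m.choose k • (u - 1) ^ k • v := by
    intro A B hAB h0
    refine (Finset.sum_subset (Finset.range_subset_range.mpr hAB) fun k _ hk => h0 k ?_).symm
    simpa using hk
  rw [h1]
  rcases le_total N (m + 1) with h | h
  · exact h2 _ _ h fun k hk => by rw [hz k hk, smul_zero]
  · exact (h2 _ _ h fun k hk => by rw [Nat.choose_eq_zero_of_lt hk, zero_smul]).symm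

theorem unipotentPow_natCast [CharZero L] {N : ℕ} {u : R} (hu : (u - 1) ^ N = 0) (m : ℕ) :
    unipotentPow N u (m : L) = u ^ m := by
  have h := pow_smul_eq_sum_choose (M := R) (v := 1) (by rw [hu, zero_smul]) m
  simp only [smul_eq_mul, mul_one] at h
  simp only [unipotentPow, eval_binomPoly_natCast, h, Nat.cast_smul_eq_nsmul]

theorem coeff_zero_unipotentPowPoly [CharZero L] {N : ℕ} (hN : 0 < N) (u : R) (c : L) :
    (unipotentPowPoly N u (C c * X)).coeff 0 = 1 := by
  obtain ⟨N, rfl⟩ := Nat.exists_eq_succ_of_ne_zero hN.ne'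
  simp [unipotentPowPoly, Finset.sum_range_succ',
    comp_C_mul_X_coeff, coeff_zero_binomPoly]

theorem coeff_one_unipotentPowPoly (N : ℕ) (u : R) (c : L) :
    (unipotentPowPoly N u (C c * X)).coeff 1 = c • unipotentLog L N u := by
  simp only [unipotentPowPoly, unipotentLog, finsetSum_coeff, coeff_C_mul, coeff_map,
    comp_C_mul_X_coeff, pow_one, Finset.smul_sum, smul_smul]
  exact Finset.sum_congr rfl fun k _ => by rw [Algebra.smul_def, Algebra.commutes, mul_comm c]

theorem evalAt_unipotentLog (N : ℕ) (p : R[X]) (s : L) :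
    evalAt s (unipotentLog L N p) = unipotentLog L N (evalAt s p) := by
  simp [unipotentLog, map_sum, map_smul, map_pow, map_sub]

theorem coeff_one_unipotentLog {N : ℕ} (hN : 2 ≤ N) {p : R[X]} (hp : p.coeff 0 = 1) :
    (unipotentLog L N p).coeff 1 = p.coeff 1 := by
  obtain ⟨N, rfl⟩ := Nat.exists_eq_add_of_le' hN
  have h0 : (p - 1).coeff 0 = 0 := by simp [hp]
  have hk : ∀ k, ((p - 1) ^ (k + 2)).coeff 1 = 0 := by
    intro k
    have h0' : ((p - 1) ^ (k + 1)).coeff 0 = 0 := by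
      rw [pow_succ, mul_coeff_zero, h0, mul_zero]
    rw [pow_succ, mul_coeff_one, h0, h0', zero_mul, mul_zero, add_zero]
  simp [unipotentLog, Finset.sum_range_succ', hk, coeff_one]

/-- The logarithm is `(u - 1)` times a unit, because its terms of higher degree are divisible by
`(u - 1) ^ 2`. -/
theorem eq_one_of_unipotentLog_eq_zero {N : ℕ} (hN : 2 ≤ N) {u : R} (hu : (u - 1) ^ N = 0)
    (h : unipotentLog L N u = 0) : u = 1 := by
  obtain ⟨N, rfl⟩ := Nat.exists_eq_add_of_le' hN
  set w : R := ∑ k ∈ Finset.range N, (binomPoly L (k + 2)).coeff 1 • (u - 1) ^ k with hw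
  have hcomm : Commute (u - 1) w := by
    refine Commute.sum_right _ _ _ fun k _ => ?_
    exact ((Commute.refl (u - 1)).pow_right k).smul_right _
  have hlog : unipotentLog L (N + 2) u = (u - 1) * (1 + (u - 1) * w) := by
    simp only [unipotentLog, Finset.sum_range_succ', binomPoly_zero, zero_add, binomPoly_one,
      coeff_X_one, one_smul, hw, mul_add, mul_one, Finset.mul_sum, mul_smul_comm,
      coeff_one, pow_succ' (u - 1)]
    rw [add_comm (u - 1)]
    simp
  have hunit : IsUnit (1 + (u - 1) * w) :=
    (hcomm.isNilpotent_mul_right ⟨_, hu⟩).isUnit_one_add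
  rw [hlog, hunit.mul_left_eq_zero, sub_eq_zero] at h
  exact h

end UnipotentPowers

open scoped commutatorElement

/-! ### Groups with unipotent one-parameter subgroups -/

section CentralCommutators

variable {Q : Type*} [Group Q] {x y : Q}

theorem commutatorElement_pow_left (h : Commute ⁅x, y⁆ x) (m : ℕ) : ⁅x ^ m, y⁆ = ⁅x, y⁆ ^ m := by
  have h1 : ⁅x ^ m, y⁆ = x ^ m * ((y * x * y⁻¹) ^ m)⁻¹ := by
    rw [conj_pow, commutatorElement_def]
    group
  have h2 : y * x * y⁻¹ = ⁅x, y⁆⁻¹ * x := by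
    rw [commutatorElement_def]
    group
  rw [h1, h2, h.inv_left.mul_pow, mul_inv_rev, mul_inv_cancel_left, inv_pow, inv_inv]

theorem commutatorElement_pow_pow (h : ∀ g, Commute ⁅x, y⁆ g) (m n : ℕ) :
    ⁅x ^ m, y ^ n⁆ = ⁅x, y⁆ ^ (m * n) := by
  have h1 : ⁅y, x ^ m⁆ = (⁅x, y⁆ ^ m)⁻¹ := by
    rw [← commutatorElement_pow_left (h x), commutatorElement_inv]
  rw [← commutatorElement_inv, commutatorElement_pow_left, h1, inv_pow, inv_inv, pow_mul]
  rw [h1]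
  exact ((h y).pow_left m).inv_left

end CentralCommutators

/-- An injective homomorphism from the group `G` to an `L`-algebra `R` with unipotent values, of
bounded order, such that the powers of its values with exponents in `L` are again values. -/
structure UnipotentRep (L : Type*) [Field L] (R : Type*) [Ring R] [Algebra L R]
    (G : Type*) [Group G] where
  toHom : G →* R
  injective : Function.Injective toHom
  length : ℕ
  two_le_length : 2 ≤ length
  pow_length : ∀ x, (toHom x - 1) ^ length = 0
  scalarPow : G → L → G
  toHom_scalarPow : ∀ x s, toHom (scalarPow x s) = unipotentPow length (toHom x) s

namespace UnipotentRep

variable {L : Type*} [Field L] {R : Type*} [Ring R] [Algebra L R]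
  {G : Type*} [Group G] (D : UnipotentRep L R G)

/-- The logarithm of a group element, an element of the ambient algebra. -/
noncomputable def log (g : G) : R := unipotentLog L D.length (D.toHom g)

/-- The power of `g` with exponent the polynomial `a`, as a polynomial over the ambient algebra. -/
noncomputable def powPoly (g : G) (a : L[X]) : R[X] := unipotentPowPoly D.length (D.toHom g) a

theorem evalAt_powPoly (g : G) (a : L[X]) (s : L) :
    evalAt s (D.powPoly g a) = D.toHom (D.scalarPow g (a.eval s)) := by
  rw [powPoly, evalAt_unipotentPowPoly, toHom_scalarPow]

theorem evalAt_powPoly_C_mul_X (g : G) (c s : L) :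
    evalAt s (D.powPoly g (C c * X)) = D.toHom (D.scalarPow g (c * s)) := by
  simp [evalAt_powPoly]

theorem coeff_one_powPoly (g : G) (c : L) :
    (D.powPoly g (C c * X)).coeff 1 = c • D.log g :=
  coeff_one_unipotentPowPoly _ _ _

theorem eq_one_of_log_eq_zero {g : G} (h : D.log g = 0) : g = 1 :=
  D.injective <| by
    rw [map_one]
    exact eq_one_of_unipotentLog_eq_zero D.two_le_length (D.pow_length g) h

variable [CharZero L]

theorem coeff_zero_powPoly (g : G) (c : L) : (D.powPoly g (C c * X)).coeff 0 = 1 :=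
  coeff_zero_unipotentPowPoly (by have := D.two_le_length; omega) _ _

theorem scalarPow_natCast (g : G) (m : ℕ) : D.scalarPow g (m : L) = g ^ m :=
  D.injective <| by rw [toHom_scalarPow, unipotentPow_natCast (D.pow_length g), map_pow]

@[simp]
theorem scalarPow_zero (g : G) : D.scalarPow g 0 = 1 := by
  simpa using D.scalarPow_natCast g 0

theorem eq_of_natCast_eq {F F' : L → G} {p p' : R[X]} (hF : ∀ s, D.toHom (F s) = evalAt s p)
    (hF' : ∀ s, D.toHom (F' s) = evalAt s p') (h : ∀ m : ℕ, F m = F' m) (s : L) : F s = F' s := by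
  have : p = p' := eq_of_evalAt_natCast_eq fun m => by rw [← hF, ← hF', h]
  exact D.injective (by rw [hF, hF', this])

/-- The identity holds for natural exponents; it extends to scalars in one exponent at a time,
since both sides are polynomials. -/
theorem scalarPow_add (g : G) (s t : L) :
    D.scalarPow g (s + t) = D.scalarPow g s * D.scalarPow g t := by
  have hright : ∀ (m : ℕ) (s : L),
      D.scalarPow g (s + m) = D.scalarPow g s * D.scalarPow g m := fun m =>
    D.eq_of_natCast_eq (F := fun s => D.scalarPow g (s + m))
      (F' := fun s => D.scalarPow g s * D.scalarPow g m)
      (p := D.powPoly g (X + C (m : L))) (p' := D.powPoly g X * C (D.toHom (D.scalarPow g m)))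
      (fun s => by rw [evalAt_powPoly, eval_add, eval_X, eval_C])
      (fun s => by rw [map_mul, map_mul, evalAt_powPoly, eval_X, evalAt_C])
      (fun n => by
        rw [← Nat.cast_add, scalarPow_natCast, scalarPow_natCast, scalarPow_natCast, pow_add])
  exact D.eq_of_natCast_eq (F := fun t => D.scalarPow g (s + t))
    (F' := fun t => D.scalarPow g s * D.scalarPow g t)
    (p := D.powPoly g (C s + X)) (p' := C (D.toHom (D.scalarPow g s)) * D.powPoly g X)
    (fun t => by rw [evalAt_powPoly, eval_add, eval_X, eval_C])
    (fun t => by rw [map_mul, map_mul, evalAt_powPoly, eval_X, evalAt_C])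
    (fun m => hright m s) t

theorem scalarPow_neg (g : G) (s : L) : D.scalarPow g (-s) = (D.scalarPow g s)⁻¹ := by
  rw [eq_inv_iff_mul_eq_one, ← scalarPow_add, neg_add_cancel, scalarPow_zero]

theorem scalarPow_sub (g : G) (s t : L) :
    D.scalarPow g (s - t) = D.scalarPow g s * (D.scalarPow g t)⁻¹ := by
  rw [sub_eq_add_neg, scalarPow_add, scalarPow_neg]

theorem scalarPow_mul_natCast (g : G) (s : L) (m : ℕ) :
    D.scalarPow g (s * m) = D.scalarPow g s ^ m := by
  induction m with
  | zero => simp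
  | succ m ih => rw [Nat.cast_succ, mul_add, mul_one, scalarPow_add, ih, pow_succ]

theorem scalarPow_mul (g : G) (s t : L) :
    D.scalarPow g (s * t) = D.scalarPow (D.scalarPow g s) t :=
  D.eq_of_natCast_eq (F := fun t => D.scalarPow g (s * t))
    (F' := fun t => D.scalarPow (D.scalarPow g s) t)
    (p := D.powPoly g (C s * X)) (p' := D.powPoly (D.scalarPow g s) X)
    (fun t => by simp [evalAt_powPoly]) (fun t => by simp [evalAt_powPoly])
    (fun m => by rw [scalarPow_mul_natCast, scalarPow_natCast]) t

theorem log_scalarPow (g : G) (s : L) : D.log (D.scalarPow g s) = s • D.log g := by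
  have : D.powPoly g (C s * X) = D.powPoly (D.scalarPow g s) (C 1 * X) :=
    eq_of_evalAt_natCast_eq fun m => by
      rw [evalAt_powPoly_C_mul_X, evalAt_powPoly_C_mul_X, scalarPow_mul, one_mul]
  rw [← coeff_one_powPoly, this, coeff_one_powPoly, one_smul]

/-- The one-parameter subgroup `s ↦ g ^ s`. -/
noncomputable def scalarPowHom (g : G) : Multiplicative L →* G where
  toFun s := D.scalarPow g s.toAdd
  map_one' := D.scalarPow_zero g
  map_mul' _ _ := D.scalarPow_add g _ _

theorem log_one : D.log 1 = 0 := by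
  simpa using D.log_scalarPow 1 (0 : L)

variable {D} {M : Subgroup G} {W : Submodule L R}

/-- A polynomial family in `G` that lies in `M = {g | log g ∈ W}` at all natural parameters lies in
`M` at all scalar parameters: `log` of the family is a polynomial with values in `W` at the natural
numbers. -/
theorem mem_of_natCast_mem (hM : ∀ g, g ∈ M ↔ D.log g ∈ W) {F : L → G} {p : R[X]}
    (hF : ∀ s, D.toHom (F s) = evalAt s p) (h : ∀ m : ℕ, F m ∈ M) (s : L) : F s ∈ M := by
  have hlog : ∀ s, D.log (F s) = evalAt s (unipotentLog L D.length p) := fun s => by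
    rw [log, hF, evalAt_unipotentLog]
  rw [hM, hlog]
  refine W.evalAt_mem_of_coeff_mem (W.coeff_mem_of_evalAt_natCast_mem fun m => ?_) s
  rw [← hlog, ← hM]
  exact h m

/-- The derivative at `0` of a polynomial family in `M = {g | log g ∈ W}` that starts at `1` lies in
`W`: its logarithm has the same linear term. -/
theorem coeff_one_mem_of_natCast_mem (hM : ∀ g, g ∈ M ↔ D.log g ∈ W) {F : L → G} {p : R[X]}
    (hF : ∀ s, D.toHom (F s) = evalAt s p) (h : ∀ m : ℕ, F m ∈ M) (hp : p.coeff 0 = 1) :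
    p.coeff 1 ∈ W := by
  rw [← coeff_one_unipotentLog (L := L) D.two_le_length hp]
  refine W.coeff_mem_of_evalAt_natCast_mem (fun m => ?_) 1
  rw [evalAt_unipotentLog, ← hF]
  exact (hM _).1 (h m)

theorem commutatorElement_scalarPow_left_mem (hM : ∀ g, g ∈ M ↔ D.log g ∈ W) [M.Normal]
    {z g : G} (hz : ⁅z, g⁆ ∈ M) (s : L) : ⁅D.scalarPow z s, g⁆ ∈ M := by
  refine mem_of_natCast_mem hM (F := fun s => ⁅D.scalarPow z s, g⁆)
    (p := D.powPoly z (C 1 * X) * C (D.toHom g) * D.powPoly z (C (-1) * X) * C (D.toHom g⁻¹))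
    (fun s => ?_) (fun m => ?_) s
  · simp only [map_mul, evalAt_powPoly_C_mul_X, evalAt_C, one_mul, neg_mul, scalarPow_neg,
      commutatorElement_def]
  · rw [scalarPow_natCast, ← QuotientGroup.eq_one_iff] at *
    have h' : ⁅(z : G ⧸ M), (g : G ⧸ M)⁆ = 1 := hz
    change ⁅(z : G ⧸ M) ^ m, (g : G ⧸ M)⁆ = 1
    rw [commutatorElement_eq_one_iff_commute] at *
    exact h'.pow_left m

/-- Modulo `W`, the logarithm is additive on elements that commute modulo `M`. -/
theorem log_mul_sub_mem (hM : ∀ g, g ∈ M ↔ D.log g ∈ W) [M.Normal]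
    {g h : G} (hgh : ⁅g, h⁆ ∈ M) : D.log g + D.log h - D.log (g * h) ∈ W := by
  have := coeff_one_mem_of_natCast_mem hM
    (F := fun s => D.scalarPow g s * D.scalarPow h s * (D.scalarPow (g * h) s)⁻¹)
    (p := D.powPoly g (C 1 * X) * D.powPoly h (C 1 * X) * D.powPoly (g * h) (C (-1) * X))
    (fun s => by
      simp only [map_mul, evalAt_powPoly_C_mul_X, one_mul, neg_mul, scalarPow_neg])
    (fun m => by
      simp only [scalarPow_natCast]
      rw [← QuotientGroup.eq_one_iff] at *
      have h' : ⁅(g : G ⧸ M), (h : G ⧸ M)⁆ = 1 := hgh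
      change (g : G ⧸ M) ^ m * (h : G ⧸ M) ^ m * (((g : G ⧸ M) * (h : G ⧸ M)) ^ m)⁻¹ = 1
      rw [commutatorElement_eq_one_iff_commute] at h'
      rw [h'.mul_pow, mul_inv_cancel])
    (by simp only [mul_coeff_zero, coeff_zero_powPoly, mul_one])
  simp only [mul_coeff_one, mul_coeff_zero, coeff_zero_powPoly, coeff_one_powPoly, mul_one,
    one_mul, one_smul, neg_smul] at this
  convert this using 1
  abel

/-- If `⁅x, y⁆` is central modulo `M`, then `⁅x ^ s, y ^ t⁆` and `⁅x, y⁆ ^ (s * t)` agree modulo `M`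
for all scalars `s` and `t`. -/
theorem commutatorElement_scalarPow_mul_mem (hM : ∀ g, g ∈ M ↔ D.log g ∈ W) [M.Normal]
    {x y : G} (hxy : ∀ g, ⁅⁅x, y⁆, g⁆ ∈ M) (s t : L) :
    ⁅D.scalarPow x s, D.scalarPow y t⁆ * (D.scalarPow ⁅x, y⁆ (s * t))⁻¹ ∈ M := by
  -- Both exponents natural, then `t` arbitrary with `m` natural, then both arbitrary.
  have hnat : ∀ m n : ℕ, ⁅x ^ m, y ^ n⁆ * (⁅x, y⁆ ^ (m * n))⁻¹ ∈ M := by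
    intro m n
    rw [← QuotientGroup.eq_one_iff]
    change ⁅(x : G ⧸ M) ^ m, (y : G ⧸ M) ^ n⁆ * (⁅(x : G ⧸ M), (y : G ⧸ M)⁆ ^ (m * n))⁻¹ = 1
    rw [commutatorElement_pow_pow, mul_inv_cancel]
    intro g
    induction g using QuotientGroup.induction_on with
    | H g => exact commutatorElement_eq_one_iff_commute.1 ((QuotientGroup.eq_one_iff _).2 (hxy g))
  have hleft : ∀ (m : ℕ) (t : L),
      ⁅D.scalarPow x m, D.scalarPow y t⁆ * (D.scalarPow ⁅x, y⁆ (m * t))⁻¹ ∈ M := by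
    intro m t
    refine mem_of_natCast_mem hM
      (F := fun t => ⁅D.scalarPow x m, D.scalarPow y t⁆ * (D.scalarPow ⁅x, y⁆ (m * t))⁻¹)
      (p := C (D.toHom (x ^ m)) * D.powPoly y (C 1 * X) * C (D.toHom (x ^ m)⁻¹) *
        D.powPoly y (C (-1) * X) * D.powPoly ⁅x, y⁆ (C (-(m : L)) * X))
      (fun t => ?_) (fun n => ?_) t
    · simp only [map_mul, evalAt_powPoly_C_mul_X, evalAt_C, one_mul, neg_mul, scalarPow_neg,
        commutatorElement_def, scalarPow_natCast]
    · rw [← Nat.cast_mul, scalarPow_natCast, scalarPow_natCast, scalarPow_natCast]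
      exact hnat m n
  refine mem_of_natCast_mem hM
    (F := fun s => ⁅D.scalarPow x s, D.scalarPow y t⁆ * (D.scalarPow ⁅x, y⁆ (s * t))⁻¹)
    (p := D.powPoly x (C 1 * X) * C (D.toHom (D.scalarPow y t)) * D.powPoly x (C (-1) * X) *
      C (D.toHom (D.scalarPow y t)⁻¹) * D.powPoly ⁅x, y⁆ (C (-t) * X))
    (fun s => ?_) (fun n => hleft n t) s
  simp only [map_mul, evalAt_powPoly_C_mul_X, evalAt_C, one_mul, neg_mul, scalarPow_neg,
    commutatorElement_def, mul_comm s t]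

end UnipotentRep

/-! ### Normal subgroups containing the commutator subgroup -/

namespace UnipotentRep

variable {L : Type*} [Field L] [CharZero L] {R : Type*} [Ring R] [Algebra L R]
  {G : Type*} [Group G] {D : UnipotentRep L R G} {M : Subgroup G} {W : Submodule L R}

/-- If `M = {g | log g ∈ W}` is normal and `z` is central modulo `M`, then the elements congruent to
a power of `z` modulo `M` form a normal subgroup, cut out by the subspace `W + L log z`. -/
theorem exists_normal_extension [M.Normal] (hM : ∀ g, g ∈ M ↔ D.log g ∈ W) {z : G}
    (hz : ∀ g, ⁅z, g⁆ ∈ M) :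
    ∃ M' : Subgroup G, M'.Normal ∧ (∀ g, g ∈ M' ↔ ∃ a, g * D.scalarPow z a ∈ M) ∧
      ∀ g, g ∈ M' ↔ D.log g ∈ W ⊔ Submodule.span L {D.log z} := by
  have hza : ∀ a g, ⁅D.scalarPow z a, g⁆ ∈ M := fun a g =>
    commutatorElement_scalarPow_left_mem hM (hz g) a
  -- The new subgroup is the preimage of the image of `a ↦ z ^ a` in `G ⧸ M`.
  let θ : Multiplicative L →* G ⧸ M := (QuotientGroup.mk' M).comp (D.scalarPowHom z)
  have hθ : ∀ a q, Commute (θ a) q := by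
    intro a q
    induction q using QuotientGroup.induction_on with
    | H g => exact commutatorElement_eq_one_iff_commute.1 ((QuotientGroup.eq_one_iff _).2 (hza _ g))
  have hnormal : θ.range.Normal := ⟨by
    rintro _ ⟨a, rfl⟩ q
    rw [← (hθ a q).eq, mul_inv_cancel_right]
    exact ⟨a, rfl⟩⟩
  have hmem : ∀ g, g ∈ θ.range.comap (QuotientGroup.mk' M) ↔ ∃ a, g * D.scalarPow z a ∈ M := by
    intro g
    rw [Subgroup.mem_comap, MonoidHom.mem_range]
    constructor
    · rintro ⟨a, ha⟩
      refine ⟨-a.toAdd, ?_⟩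
      rw [D.scalarPow_neg, ← QuotientGroup.eq_one_iff, QuotientGroup.mk_mul,
        QuotientGroup.mk_inv, mul_inv_eq_one]
      exact ha.symm
    · rintro ⟨a, ha⟩
      refine ⟨Multiplicative.ofAdd (-a), ?_⟩
      rw [← QuotientGroup.eq_one_iff, QuotientGroup.mk_mul, mul_eq_one_iff_eq_inv] at ha
      change ((D.scalarPow z (-a) : G) : G ⧸ M) = g
      rw [ha, D.scalarPow_neg, QuotientGroup.mk_inv]
  refine ⟨θ.range.comap (QuotientGroup.mk' M), inferInstance, hmem, fun g => ?_⟩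
  have hlog : ∀ a, D.log g + a • D.log z - D.log (g * D.scalarPow z a) ∈ W := fun a => by
    rw [← D.log_scalarPow]
    refine log_mul_sub_mem hM ?_
    rw [← commutatorElement_inv]
    exact M.inv_mem (hza a g)
  rw [hmem, Submodule.mem_sup]
  constructor
  · rintro ⟨a, ha⟩
    refine ⟨D.log g + a • D.log z, ?_, -a • D.log z, Submodule.mem_span_singleton.2 ⟨_, rfl⟩, ?_⟩
    · simpa using W.add_mem (hlog a) ((hM _).1 ha)
    · rw [neg_smul, add_neg_cancel_right]
  · rintro ⟨v, hv, w, hw, hvw⟩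
    obtain ⟨a, rfl⟩ := Submodule.mem_span_singleton.1 hw
    refine ⟨-a, (hM _).2 ?_⟩
    have := W.sub_mem hv (hlog (-a))
    rw [← hvw] at this
    convert this using 1
    rw [neg_smul]
    abel

/-- For `s ≠ 0` with `x ^ s ∈ K`, the element `⁅x ^ s, y ^ (a / s)⁆` of `K` is congruent to
`⁅x, y⁆ ^ a` modulo `M`. -/
theorem scalarPow_commutatorElement_mem (hM : ∀ g, g ∈ M ↔ D.log g ∈ W) [M.Normal]
    {K : Subgroup G} [K.Normal] (hMK : M ≤ K) (hK : ∀ x, ∃ s : L, s ≠ 0 ∧ D.scalarPow x s ∈ K)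
    {x y : G} (hxy : ∀ g, ⁅⁅x, y⁆, g⁆ ∈ M) (a : L) : D.scalarPow ⁅x, y⁆ a ∈ K := by
  obtain ⟨s, hs, hsK⟩ := hK x
  have h1 := hMK (commutatorElement_scalarPow_mul_mem hM hxy s (s⁻¹ * a))
  rw [mul_inv_cancel_left₀ hs] at h1
  have h2 : ⁅D.scalarPow x s, D.scalarPow y (s⁻¹ * a)⁆ ∈ K := by
    rw [commutatorElement_def, mul_assoc, mul_assoc, ← mul_assoc (D.scalarPow y _)]
    exact K.mul_mem hsK (Subgroup.Normal.conj_mem inferInstance _ (K.inv_mem hsK) _)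
  exact inv_mem_iff.1 ((K.mul_mem_cancel_left h2).1 h1)

/-- The commutator is found in the last term of the lower central series that `M` does not
contain. -/
theorem exists_commutatorElement_notMem [Group.IsNilpotent G] (h : ¬ commutator G ≤ M) :
    ∃ x y : G, ⁅x, y⁆ ∉ M ∧ ∀ g, ⁅⁅x, y⁆, g⁆ ∈ M := by
  classical
  have hex : ∃ n, (⊤ : Subgroup G).lowerCentralSeries n ≤ M := by
    obtain ⟨n, hn⟩ := Subgroup.nilpotent_iff_lowerCentralSeries.1 ‹Group.IsNilpotent G›
    exact ⟨n, hn ▸ bot_le⟩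
  have hn := Nat.find_spec hex
  have hmin : ∀ m < Nat.find hex, ¬ (⊤ : Subgroup G).lowerCentralSeries m ≤ M :=
    fun m => Nat.find_min hex
  generalize Nat.find hex = n at hn hmin
  match n, hn, hmin with
  | 0, hn, _ => exact absurd (le_top.trans hn) h
  | 1, hn, _ => exact absurd hn h
  | n + 2, hn, hmin =>
    have h1 := hmin (n + 1) (by omega)
    rw [Subgroup.lowerCentralSeries_succ, Subgroup.commutator_le] at h1
    push Not at h1
    obtain ⟨x, hx, y, hy, hxy⟩ := h1
    exact ⟨x, y, hxy, fun g => hn (Subgroup.commutator_mem_commutator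
      (Subgroup.commutator_mem_commutator hx hy) (Subgroup.mem_top g))⟩

theorem commutator_le_of_exists_scalarPow_mem [FiniteDimensional L R] [Group.IsNilpotent G]
    (D : UnipotentRep L R G) (K : Subgroup G) [K.Normal]
    (hK : ∀ x, ∃ s : L, s ≠ 0 ∧ D.scalarPow x s ∈ K) : commutator G ≤ K := by
  let S : Set (Submodule L R) := {W | ∃ M : Subgroup G,
    M.Normal ∧ M ≤ K ∧ ∀ g, g ∈ M ↔ D.log g ∈ W}
  have hS : S.Nonempty := ⟨⊥, ⊥, inferInstance, bot_le, fun g => by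
    rw [Subgroup.mem_bot, Submodule.mem_bot]
    exact ⟨fun h => h ▸ D.log_one, D.eq_one_of_log_eq_zero⟩⟩
  obtain ⟨W, ⟨M, hMn, hMK, hM⟩, hmax⟩ := set_has_maximal_iff_noetherian.2 inferInstance S hS
  by_contra hcon
  obtain ⟨x, y, hxyM, hxy⟩ := exists_commutatorElement_notMem fun h : commutator G ≤ M =>
    hcon (h.trans hMK)
  obtain ⟨M', hM'n, hM', hM'W⟩ := exists_normal_extension hM hxy
  refine hmax _ ⟨M', hM'n, fun g hg => ?_, hM'W⟩ (left_lt_sup.2 fun hle => hxyM ?_)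
  · obtain ⟨a, ha⟩ := (hM' g).1 hg
    exact (K.mul_mem_cancel_right (scalarPow_commutatorElement_mem hM hMK hK hxy a)).1 (hMK ha)
  · exact (hM _).2 (hle (Submodule.mem_span_singleton_self _))

end UnipotentRep

/-! ### Groups of unipotent operators are nilpotent -/

section UnipotentGroupsAreNilpotent

attribute [local instance] LieRing.ofAssociativeRing

variable {L : Type*} [Field L] {V : Type*} [AddCommGroup V] [Module L V]

/-- In characteristic zero an operator whose positive powers all have trace zero is nilpotent. If
the minimal polynomial is `X ^ k * q` with `q 0 ≠ 0`, then the projection onto the kernel of `q` is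
a polynomial in the operator without constant term, so its trace, which is its rank, is zero. -/
theorem Module.End.isNilpotent_of_trace_pow_eq_zero [CharZero L] [FiniteDimensional L V]
    {a : Module.End L V}
    (h : ∀ k : ℕ, LinearMap.trace L V (a ^ (k + 1)) = 0) : IsNilpotent a := by
  have hμ : minpoly L a ≠ 0 := minpoly.ne_zero (Algebra.IsIntegral.isIntegral a)
  obtain ⟨q, hq, hXq⟩ := exists_eq_pow_rootMultiplicity_mul_and_not_dvd (minpoly L a) hμ 0
  set k := rootMultiplicity 0 (minpoly L a)
  rw [C_0, sub_zero] at hq hXq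
  have hcop : IsCoprime (X ^ (k + 1)) q :=
    ((irreducible_X.coprime_iff_not_dvd).2 hXq).pow_left
  -- The Bézout identity makes `r * X ^ (k + 1)` idempotent modulo the minimal polynomial. The
  -- exponent `k + 1` rather than `k` ensures that this polynomial has no constant term even if
  -- `k = 0`.
  obtain ⟨r, t, hrt⟩ := hcop
  have hμa : aeval a (X ^ k * q) = 0 := by rw [← hq, minpoly.aeval]
  have htrace : ∀ g : L[X], LinearMap.trace L V (aeval a (g * X)) = 0 := by
    intro g
    rw [map_mul, aeval_X, aeval_eq_sum_range, Finset.sum_mul, map_sum]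
    refine Finset.sum_eq_zero fun i _ => ?_
    rw [smul_mul_assoc, ← pow_succ, map_smul, h, smul_zero]
  have he : IsIdempotentElem (aeval a (r * X ^ (k + 1))) := by
    have : r * X ^ (k + 1) * (r * X ^ (k + 1)) =
        r * X ^ (k + 1) - r * X * t * (X ^ k * q) := by
      linear_combination (r * X ^ (k + 1)) * hrt
    rw [IsIdempotentElem, ← map_mul, this, map_sub, map_mul _ _ (X ^ k * q), hμa, mul_zero,
      sub_zero]
  have he0 : aeval a (r * X ^ (k + 1)) = 0 :=
    LinearMap.IsIdempotentElem.eq_zero_of_trace_eq_zero he <| by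
      rw [pow_succ, ← mul_assoc]
      exact htrace _
  refine ⟨k, ?_⟩
  have : (X : L[X]) ^ k = X ^ k * (r * X ^ (k + 1)) + t * (X ^ k * q) := by
    linear_combination (-X ^ k) * hrt
  rw [← aeval_X_pow (R := L) a, this, map_add, map_mul, map_mul _ t, he0, hμa, mul_zero,
    mul_zero, add_zero]

variable {G : Type*} [Group G] (ρ : G →* Module.End L V)

/-- The linear span of the operators `ρ g - 1`, the image of the augmentation ideal of the group
algebra. -/
def augmentationSpan : Submodule L (Module.End L V) :=
  Submodule.span L (Set.range fun g => ρ g - 1)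

variable {ρ}

theorem sub_one_mem_augmentationSpan (g : G) : ρ g - 1 ∈ augmentationSpan ρ :=
  Submodule.subset_span ⟨g, rfl⟩

theorem augmentationSpan_mul_self_le :
    augmentationSpan ρ * augmentationSpan ρ ≤ augmentationSpan ρ := by
  conv_lhs => rw [augmentationSpan, Submodule.span_mul_span]
  rw [Submodule.span_le]
  rintro _ ⟨_, ⟨g, rfl⟩, _, ⟨h, rfl⟩, rfl⟩
  have : (ρ g - 1) * (ρ h - 1) = (ρ (g * h) - 1) - (ρ g - 1) - (ρ h - 1) := by
    rw [map_mul]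
    noncomm_ring
  change (ρ g - 1) * (ρ h - 1) ∈ _
  rw [this]
  exact sub_mem (sub_mem (sub_one_mem_augmentationSpan _) (sub_one_mem_augmentationSpan _))
    (sub_one_mem_augmentationSpan _)

theorem isNilpotent_of_mem_augmentationSpan [CharZero L] [FiniteDimensional L V]
    (hρ : ∀ g, IsNilpotent (ρ g - 1))
    {a : Module.End L V} (ha : a ∈ augmentationSpan ρ) : IsNilpotent a := by
  have htrace : ∀ b ∈ augmentationSpan ρ, LinearMap.trace L V b = 0 := by
    have : augmentationSpan ρ ≤ LinearMap.ker (LinearMap.trace L V) := by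
      refine Submodule.span_le.2 ?_
      rintro _ ⟨g, rfl⟩
      exact (LinearMap.isNilpotent_trace_of_isNilpotent (hρ g)).eq_zero
    exact fun b hb => this hb
  refine Module.End.isNilpotent_of_trace_pow_eq_zero fun k => htrace _ ?_
  induction k with
  | zero => simpa using ha
  | succ k ih =>
    rw [pow_succ]
    exact augmentationSpan_mul_self_le (Submodule.mul_mem_mul ih ha)

theorem exists_augmentationSpan_pow_eq_bot [CharZero L] [FiniteDimensional L V]
    (hρ : ∀ g, IsNilpotent (ρ g - 1)) :
    ∃ n, augmentationSpan ρ ^ n = ⊥ := by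
  let K : LieSubalgebra L (Module.End L V) :=
    { augmentationSpan ρ with
      lie_mem' := fun {a b} ha hb => by
        rw [Ring.lie_def]
        exact sub_mem (augmentationSpan_mul_self_le (Submodule.mul_mem_mul ha hb))
          (augmentationSpan_mul_self_le (Submodule.mul_mem_mul hb ha)) }
  have hK : LieModule.IsNilpotent K V :=
    (LieModule.isNilpotent_iff_forall' (R := L)).2 fun x =>
      isNilpotent_of_mem_augmentationSpan hρ x.2
  obtain ⟨n, hn⟩ := (LieModule.isNilpotent_iff L K V).1 hK
  -- A product of `j` elements of `K` maps `V` into the `j`-th term of its lower central series.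
  have hmem : ∀ j, ∀ a ∈ augmentationSpan ρ ^ j, ∀ v,
      a v ∈ LieModule.lowerCentralSeries L K V j := by
    intro j
    induction j with
    | zero => intro a _ v; simp
    | succ j ih =>
      intro a ha v
      rw [pow_succ'] at ha
      induction ha using Submodule.mul_induction_on' with
      | mem_mul_mem b hb c hc =>
        rw [LieModule.lowerCentralSeries_succ]
        exact LieSubmodule.lie_mem_lie (x := (⟨b, hb⟩ : K)) (LieSubmodule.mem_top _) (ih c hc v)
      | add b _ c _ hb hc => exact add_mem hb hc
  refine ⟨n, eq_bot_iff.2 fun a ha => ?_⟩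
  rw [Submodule.mem_bot]
  ext v
  have := hmem n a ha v
  rwa [hn, LieSubmodule.mem_bot] at this

theorem mul_mem_augmentationSpan_pow {j : ℕ} {a : Module.End L V}
    (ha : a ∈ augmentationSpan ρ ^ (j + 1)) (h : G) : a * ρ h ∈ augmentationSpan ρ ^ (j + 1) := by
  have h1 : a * ρ h = a + a * (ρ h - 1) := by noncomm_ring
  have h2 : augmentationSpan ρ ^ (j + 1) * augmentationSpan ρ ≤ augmentationSpan ρ ^ (j + 1) := by
    rw [pow_succ, mul_assoc]
    exact mul_le_mul_right (augmentationSpan_mul_self_le (ρ := ρ)) _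
  rw [h1]
  exact add_mem ha (h2 (Submodule.mul_mem_mul ha (sub_one_mem_augmentationSpan h)))

/-- The elements that act trivially up to the `(j + 1)`-st power of the augmentation span. The shift
by one makes the term with `j = 0` the whole group. -/
def augmentationSubgroup (ρ : G →* Module.End L V) (j : ℕ) : Subgroup G where
  carrier := {g | ρ g - 1 ∈ augmentationSpan ρ ^ (j + 1)}
  one_mem' := by simp
  mul_mem' {g h} hg hh := by
    have : ρ (g * h) - 1 = (ρ g - 1) * ρ h + (ρ h - 1) := by rw [map_mul]; noncomm_ring
    rw [Set.mem_ofPred_eq, this]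
    exact add_mem (mul_mem_augmentationSpan_pow hg h) hh
  inv_mem' {g} hg := by
    have : ρ g⁻¹ - 1 = -((ρ g - 1) * ρ g⁻¹) := by
      rw [sub_mul, ← map_mul, mul_inv_cancel, map_one, one_mul, neg_sub]
    rw [Set.mem_ofPred_eq, this]
    exact neg_mem (mul_mem_augmentationSpan_pow hg _)

/-- A group of unipotent operators on a finite-dimensional space in characteristic zero is
nilpotent. -/
theorem group_isNilpotent_of_forall_isNilpotent_sub_one [CharZero L] [FiniteDimensional L V]
    (hinj : Function.Injective ρ)
    (hρ : ∀ g, IsNilpotent (ρ g - 1)) : Group.IsNilpotent G := by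
  obtain ⟨n, hn⟩ := exists_augmentationSpan_pow_eq_bot hρ
  refine (Subgroup.nilpotent_iff_finite_descending_central_series G).2
    ⟨n, augmentationSubgroup ρ, ⟨?_, fun g j hg h => ?_⟩, ?_⟩
  · refine eq_top_iff.2 fun g _ => ?_
    change ρ g - 1 ∈ augmentationSpan ρ ^ (0 + 1)
    rw [zero_add, pow_one]
    exact sub_one_mem_augmentationSpan g
  · change ρ g - 1 ∈ augmentationSpan ρ ^ (j + 1) at hg
    change ρ ⁅g, h⁆ - 1 ∈ augmentationSpan ρ ^ (j + 1 + 1)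
    have h1 : ρ ⁅g, h⁆ - 1 =
        ((ρ g - 1) * (ρ h - 1) - (ρ h - 1) * (ρ g - 1)) * ρ (g⁻¹ * h⁻¹) := by
      have h2 : (ρ g - 1) * (ρ h - 1) - (ρ h - 1) * (ρ g - 1) = ρ (g * h) - ρ (h * g) := by
        rw [map_mul, map_mul]
        noncomm_ring
      rw [h2, sub_mul, ← map_mul, ← map_mul, commutatorElement_def, ← map_one ρ]
      congr 2 <;> group
    have hI := sub_one_mem_augmentationSpan (ρ := ρ) h
    rw [h1]
    refine mul_mem_augmentationSpan_pow (sub_mem ?_ ?_) _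
    · rw [pow_succ]
      exact Submodule.mul_mem_mul hg hI
    · rw [pow_succ']
      exact Submodule.mul_mem_mul hI hg
  · refine eq_bot_iff.2 fun g hg => ?_
    change ρ g - 1 ∈ augmentationSpan ρ ^ (n + 1) at hg
    rw [pow_succ, hn, Submodule.bot_mul, Submodule.mem_bot, sub_eq_zero, ← map_one ρ] at hg
    exact hinj hg

end UnipotentGroupsAreNilpotent

/-! ### Rational points of unipotent groups -/

namespace LinearAlgebraicGroup

section RightTranslation

variable {k A : Type*} [Field k] [CommRing A] [HopfAlgebra k A]

theorem rightTranslation_apply (g : RationalPoints k A) (f : A) :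
    rightTranslation g f =
      ∑ i ∈ (Coalgebra.Repr.arbitrary k f).index,
        g.ofConv ((Coalgebra.Repr.arbitrary k f).right i) •
          (Coalgebra.Repr.arbitrary k f).left i := by
  rw [rightTranslation, LinearMap.comp_apply, LinearMap.comp_apply,
    ← (Coalgebra.Repr.arbitrary k f).eq]
  simp

theorem counit_rightTranslation (g : RationalPoints k A) (f : A) :
    Coalgebra.counit (R := k) (rightTranslation g f) = g.ofConv f := by
  have key : ∀ x : A ⊗[k] A,
      Coalgebra.counit (R := k) ((TensorProduct.rid k A)
        (TensorProduct.map LinearMap.id g.ofConv.toLinearMap x)) =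
      g.ofConv (TensorProduct.lid k A ((Coalgebra.counit (R := k) (A := A)).rTensor A x)) := by
    intro x
    induction x with
    | zero => simp
    | tmul a b => simp [mul_comm]
    | add x y hx hy => simp only [map_add, hx, hy]
  refine (key (Coalgebra.comul f)).trans ?_
  rw [Coalgebra.rTensor_counit_comul]
  simp

theorem rightTranslation_one : rightTranslation (1 : RationalPoints k A) = 1 := by
  ext f
  have key : ∀ x : A ⊗[k] A,
      TensorProduct.map LinearMap.id (1 : RationalPoints k A).ofConv.toLinearMap x =
        (Coalgebra.counit (R := k) (A := A)).lTensor A x := fun x => rfl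
  change TensorProduct.rid k A (TensorProduct.map LinearMap.id _ (Coalgebra.comul f)) = f
  rw [key, Coalgebra.lTensor_counit_comul]
  simp

theorem rightTranslation_mul (g h : RationalPoints k A) :
    rightTranslation (g * h) = rightTranslation g * rightTranslation h := by
  ext f
  -- Both sides are `T`, which maps `a ⊗ b ⊗ c` to `g b * h c • a`, applied to the two expressions
  -- for the iterated comultiplication of `f`.
  let T : A ⊗[k] (A ⊗[k] A) →ₗ[k] A :=
    (TensorProduct.rid k A).toLinearMap ∘ₗ TensorProduct.map LinearMap.id
      (LinearMap.mul' k k ∘ₗ TensorProduct.map g.ofConv.toLinearMap h.ofConv.toLinearMap)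
  have h1 : ∀ x : A ⊗[k] A, TensorProduct.rid k A (TensorProduct.map LinearMap.id
      (g * h).ofConv.toLinearMap x) = T ((Coalgebra.comul (R := k) (A := A)).lTensor A x) := by
    intro x
    induction x with
    | zero => simp
    | tmul a b => rfl
    | add x y hx hy => simp only [map_add, hx, hy]
  have h2 : ∀ (b : A) (y : A ⊗[k] A), h.ofConv b • TensorProduct.rid k A
      (TensorProduct.map LinearMap.id g.ofConv.toLinearMap y) =
        T (TensorProduct.assoc k A A A (y ⊗ₜ b)) := by
    intro b y
    induction y with
    | zero => simp
    | tmul a c => simp [T, smul_smul, mul_comm]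
    | add x y hx hy => simp only [map_add, smul_add, TensorProduct.add_tmul, hx, hy]
  have h3 : ∀ x : A ⊗[k] A, rightTranslation g (TensorProduct.rid k A
      (TensorProduct.map LinearMap.id h.ofConv.toLinearMap x)) =
        T (TensorProduct.assoc k A A A ((Coalgebra.comul (R := k) (A := A)).rTensor A x)) := by
    intro x
    induction x with
    | zero => simp
    | tmul a b =>
      rw [LinearMap.rTensor_tmul, ← h2, TensorProduct.map_tmul, TensorProduct.rid_tmul, map_smul]
      rfl
    | add x y hx hy => simp only [map_add, hx, hy]
  refine (h1 _).trans ?_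
  rw [← Coalgebra.coassoc_apply]
  exact (h3 _).symm

/-- Right translation as a representation of the group of rational points on `k[G]`. -/
noncomputable def rightTranslationHom (k A : Type*) [Field k] [CommRing A] [HopfAlgebra k A] :
    RationalPoints k A →* Module.End k A where
  toFun := rightTranslation
  map_one' := rightTranslation_one
  map_mul' := rightTranslation_mul

theorem rightTranslation_pow (g : RationalPoints k A) (m : ℕ) :
    rightTranslation (g ^ m) = (rightTranslation g : Module.End k A) ^ m :=
  map_pow (rightTranslationHom k A) g m

/-- The span of the translates of finitely many generators is finite-dimensional, because all
translates of `f` lie in the span of the left tensor factors of `Δ f`. -/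
theorem exists_finiteDimensional_stable_generating [Algebra.FiniteType k A] :
    ∃ V : Submodule k A, FiniteDimensional k V ∧
      (∀ (g : RationalPoints k A), ∀ v ∈ V, rightTranslation g v ∈ V) ∧
        Algebra.adjoin k (V : Set A) = ⊤ := by
  classical
  obtain ⟨S, hS⟩ := (inferInstance : Algebra.FiniteType k A).out
  let V : Submodule k A := Submodule.span k
    {a | ∃ (g : RationalPoints k A), ∃ f ∈ S, rightTranslation g f = a}
  refine ⟨V, ?_, fun g v hv => ?_, ?_⟩
  · let T : Finset A := S.biUnion fun f =>
      (Coalgebra.Repr.arbitrary k f).index.image (Coalgebra.Repr.arbitrary k f).left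
    have hle : V ≤ Submodule.span k (T : Set A) := by
      refine Submodule.span_le.2 ?_
      rintro _ ⟨g, f, hf, rfl⟩
      rw [SetLike.mem_coe, rightTranslation_apply]
      refine Submodule.sum_mem _ fun i hi => Submodule.smul_mem _ _ (Submodule.subset_span ?_)
      exact Finset.mem_coe.2 (Finset.mem_biUnion.2 ⟨f, hf, Finset.mem_image_of_mem _ hi⟩)
    have : FiniteDimensional k (Submodule.span k (T : Set A)) :=
      FiniteDimensional.span_finset k T
    exact Submodule.finiteDimensional_of_le hle
  · have hle : V ≤ V.comap (rightTranslation g) := by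
      refine Submodule.span_le.2 ?_
      rintro _ ⟨h, f, hf, rfl⟩
      refine Submodule.subset_span ⟨g * h, f, hf, ?_⟩
      rw [rightTranslation_mul]
      rfl
    exact hle hv
  · rw [eq_top_iff, ← hS]
    refine Algebra.adjoin_mono fun f hf => Submodule.subset_span ⟨1, f, hf, ?_⟩
    rw [rightTranslation_one]
    rfl

end RightTranslation

section BaseChange

variable {L A : Type*} [Field L] [CommRing A] [HopfAlgebra L A]

/-- A rational point over `L` is also a point of the base change to `K`, and its right translation
there extends the one on `L[G]`. -/
theorem exists_baseChange_rightTranslation (K : Type*) [Field K] [Algebra L K]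
    (g : RationalPoints L A) :
    ∃ g' : RationalPoints K (K ⊗[L] A), ∀ f : A,
      rightTranslation g' (1 ⊗ₜ f) = 1 ⊗ₜ[L] rightTranslation g f := by
  let ψ : K ⊗[L] A →ₐ[K] K :=
    Algebra.TensorProduct.lift (AlgHom.id K K) ((Algebra.ofId L K).comp g.ofConv)
      fun _ _ => Commute.all _ _
  refine ⟨WithConv.toConv ψ, fun f => ?_⟩
  have key : ∀ x : A ⊗[L] A,
      TensorProduct.rid K (K ⊗[L] A) (TensorProduct.map LinearMap.id ψ.toLinearMap
        (TensorProduct.AlgebraTensorModule.tensorTensorTensorComm L K L K K K A A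
          ((1 ⊗ₜ[K] 1) ⊗ₜ[L] x))) =
      1 ⊗ₜ[L] TensorProduct.rid L A (TensorProduct.map LinearMap.id g.ofConv.toLinearMap x) := by
    intro x
    induction x with
    | zero => simp
    | tmul a b =>
      suffices algebraMap L K (g.ofConv b) ⊗ₜ[L] a = 1 ⊗ₜ[L] (algebraMap L A (g.ofConv b) * a) by
        simpa [ψ, Algebra.ofId_apply, Algebra.smul_def] using this
      rw [← Algebra.smul_def, ← TensorProduct.smul_tmul, Algebra.algebraMap_eq_smul_one]
    | add x y hx hy => simp only [map_add, TensorProduct.tmul_add, hx, hy]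
  exact key (Coalgebra.comul f)

theorem IsUnipotent.isUnipotentElement (hU : IsUnipotent L A) (g : RationalPoints L A) :
    IsUnipotentElement g := by
  intro f
  obtain ⟨g', hg'⟩ := exists_baseChange_rightTranslation (AlgebraicClosure L) g
  obtain ⟨n, hn⟩ := hU g' (1 ⊗ₜ f)
  refine ⟨n, ?_⟩
  have key : ∀ m : ℕ, ((rightTranslation g' - 1 : Module.End _ _) ^ m) (1 ⊗ₜ f) =
      1 ⊗ₜ[L] ((rightTranslation g - 1 : Module.End L A) ^ m) f := by
    intro m
    induction m with
    | zero => rfl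
    | succ m ih =>
      rw [pow_succ', pow_succ', Module.End.mul_apply, Module.End.mul_apply, ih,
        LinearMap.sub_apply, LinearMap.sub_apply, hg', TensorProduct.tmul_sub]
      rfl
  rw [key] at hn
  have hinj : Function.Injective
      (Algebra.TensorProduct.includeRight : A →ₐ[L] AlgebraicClosure L ⊗[L] A) :=
    Algebra.TensorProduct.includeRight_injective
      (FaithfulSMul.algebraMap_injective L (AlgebraicClosure L))
  exact hinj (by rw [map_zero]; exact hn)

end BaseChange

section ScalarPowers

variable {L A : Type*} [Field L] [CharZero L] [CommRing A] [HopfAlgebra L A]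

/-- For a unipotent point `g` and a function `f`, the value `f (g ^ m)` is polynomial in `m`. -/
theorem exists_polynomial_eval_natCast_eq_pow_apply {g : RationalPoints L A}
    (hg : IsUnipotentElement g) (f : A) :
    ∃ p : L[X], ∀ m : ℕ, p.eval (m : L) = (g ^ m).ofConv f := by
  obtain ⟨N, hN⟩ := hg f
  refine ⟨∑ k ∈ Finset.range N, C (Coalgebra.counit (R := L)
    (((rightTranslation g - 1 : Module.End L A) ^ k) f)) * binomPoly L k, fun m => ?_⟩
  rw [← counit_rightTranslation, rightTranslation_pow]
  have h := pow_smul_eq_sum_choose (M := A) (u := (rightTranslation g : Module.End L A)) hN m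
  simp only [Module.End.smul_def] at h
  rw [h, eval_finsetSum, map_sum]
  refine Finset.sum_congr rfl fun k _ => ?_
  rw [eval_mul, eval_C, eval_binomPoly_natCast, map_nsmul, nsmul_eq_mul, mul_comm]

/-- The power `g ^ s` of a unipotent point with a scalar exponent. Evaluating the interpolating
polynomials at `s` is an algebra homomorphism since the interpolating polynomial of a function is
unique. -/
theorem exists_rationalPoint_interpolating_pow {g : RationalPoints L A}
    (hg : IsUnipotentElement g) (s : L) :
    ∃ y : RationalPoints L A, ∀ f, ∃ p : L[X],
      (∀ m : ℕ, p.eval (m : L) = (g ^ m).ofConv f) ∧ y.ofConv f = p.eval s := by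
  choose p hp using exists_polynomial_eval_natCast_eq_pow_apply hg
  have hadd : ∀ f f', p (f + f') = p f + p f' := fun f f' =>
    Polynomial.eq_of_eval_natCast_eq fun m => by simp only [eval_add, hp, map_add]
  have hmul : ∀ f f', p (f * f') = p f * p f' := fun f f' =>
    Polynomial.eq_of_eval_natCast_eq fun m => by simp only [eval_mul, hp, map_mul]
  have halg : ∀ c : L, p (algebraMap L A c) = C c := fun c =>
    Polynomial.eq_of_eval_natCast_eq fun m => by
      rw [eval_C, hp, AlgHom.commutes]
      rfl
  have h1 : p 1 = 1 := by simpa using halg 1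
  have h0 : p 0 = 0 := by simpa using halg 0
  let ψ : A →ₐ[L] L :=
    { toFun := fun f => (p f).eval s
      map_one' := by rw [h1, eval_one]
      map_mul' := fun f f' => by rw [hmul, eval_mul]
      map_zero' := by rw [h0, eval_zero]
      map_add' := fun f f' => by rw [hadd, eval_add]
      commutes' := fun c => by rw [halg, eval_C]; rfl }
  exact ⟨WithConv.toConv ψ, fun f => ⟨p f, hp f, rfl⟩⟩

end ScalarPowers

section FaithfulRepresentation

variable {L A : Type*} [Field L] [CommRing A] [HopfAlgebra L A] (V : Submodule L A)
  (hV : ∀ (g : RationalPoints L A), ∀ v ∈ V, rightTranslation g v ∈ V)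

/-- The representation by right translations on a stable subspace `V` of the coordinate ring. -/
noncomputable def restrictedTranslation : RationalPoints L A →* Module.End L V where
  toFun g := (rightTranslation g).restrict (hV g)
  map_one' := by
    ext v
    simp [rightTranslation_one]
  map_mul' g h := by
    ext v
    simp [rightTranslation_mul]

@[simp]
theorem coe_restrictedTranslation_apply (g : RationalPoints L A) (v : V) :
    (restrictedTranslation V hV g v : A) = rightTranslation g v := rfl

theorem coe_restrictedTranslation_sub_one_pow_apply (g : RationalPoints L A) (n : ℕ) (v : V) :
    (((restrictedTranslation V hV g - 1) ^ n) v : A) =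
      ((rightTranslation g - 1 : Module.End L A) ^ n) v := by
  induction n with
  | zero => rfl
  | succ n ih =>
    rw [pow_succ', pow_succ', Module.End.mul_apply, Module.End.mul_apply, ← ih]
    rfl

theorem isNilpotent_restrictedTranslation_sub_one [FiniteDimensional L V]
    {g : RationalPoints L A} (hg : IsUnipotentElement g) :
    IsNilpotent (restrictedTranslation V hV g - 1) := by
  rw [Module.End.isNilpotent_iff_of_finite]
  intro v
  obtain ⟨n, hn⟩ := hg v
  refine ⟨n, Subtype.ext ?_⟩
  rw [coe_restrictedTranslation_sub_one_pow_apply, hn]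
  rfl

theorem restrictedTranslation_injective (hgen : Algebra.adjoin L (V : Set A) = ⊤) :
    Function.Injective (restrictedTranslation V hV) := by
  intro g h hgh
  apply WithConv.ofConv_injective
  refine AlgHom.ext_of_adjoin_eq_top hgen fun v hv => ?_
  have := congrArg (fun T : Module.End L V => (T ⟨v, hv⟩ : A)) hgh
  simp only [coe_restrictedTranslation_apply] at this
  rw [← counit_rightTranslation, this, counit_rightTranslation]

/-- The interpolated power of a point acts on `V` as the binomial series in its right translation:
both are polynomial in the exponent, and they agree at natural numbers. -/
theorem exists_restrictedTranslation_eq_unipotentPow [CharZero L] {g : RationalPoints L A}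
    (hg : IsUnipotentElement g) {N : ℕ} (hN : (restrictedTranslation V hV g - 1) ^ N = 0) (s : L) :
    ∃ y, restrictedTranslation V hV y = unipotentPow N (restrictedTranslation V hV g) s := by
  obtain ⟨y, hy⟩ := exists_rationalPoint_interpolating_pow hg s
  choose p hp hyp using hy
  refine ⟨y, LinearMap.ext fun v => Subtype.ext ?_⟩
  -- With `Δ v = ∑ aᵢ ⊗ bᵢ`, the polynomial `q` is `∑ bᵢ (g ^ X) aᵢ` and `q'` is the binomial series
  -- of the translation by `g` applied to `v`.
  let 𝓡 := Coalgebra.Repr.arbitrary L (v : A)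
  let q : A[X] := ∑ i ∈ 𝓡.index, C (𝓡.left i) * (p (𝓡.right i)).map (algebraMap L A)
  let q' : A[X] := ∑ k ∈ Finset.range N,
    C ((((restrictedTranslation V hV g - 1) ^ k) v : A)) * (binomPoly L k).map (algebraMap L A)
  have hq : ∀ t, evalAt t q = ∑ i ∈ 𝓡.index, (p (𝓡.right i)).eval t • 𝓡.left i := fun t => by
    simp only [q, map_sum, map_mul, evalAt_C, evalAt_map]
    exact Finset.sum_congr rfl fun i _ => by rw [Algebra.smul_def, mul_comm]
  have hq' : ∀ t : L, evalAt t q' = (unipotentPow N (restrictedTranslation V hV g) t v : V) :=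
      fun t => by
    simp only [q', map_sum, map_mul, evalAt_C, evalAt_map, unipotentPow, LinearMap.sum_apply,
      LinearMap.smul_apply, AddSubmonoidClass.coe_finsetSum, Submodule.coe_smul]
    exact Finset.sum_congr rfl fun i _ => by rw [Algebra.smul_def, mul_comm]
  have hqq' : q = q' := eq_of_evalAt_natCast_eq fun m => by
    rw [hq, hq', unipotentPow_natCast hN, ← map_pow, coe_restrictedTranslation_apply,
      rightTranslation_apply]
    exact Finset.sum_congr rfl fun i _ => by rw [hp]
  rw [← hq', ← hqq', hq, coe_restrictedTranslation_apply, rightTranslation_apply]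
  exact Finset.sum_congr rfl fun i _ => by rw [hyp]

end FaithfulRepresentation

theorem IsUnipotent.exists_unipotentRep {L A : Type*} [Field L] [CharZero L] [CommRing A]
    [HopfAlgebra L A] [Algebra.FiniteType L A] (hU : IsUnipotent L A) :
    Group.IsNilpotent (RationalPoints L A) ∧ ∃ V : Submodule L A, FiniteDimensional L V ∧
      Nonempty (UnipotentRep L (Module.End L V) (RationalPoints L A)) := by
  obtain ⟨V, hfin, hV, hgen⟩ := exists_finiteDimensional_stable_generating (k := L) (A := A)
  have hinj := restrictedTranslation_injective V hV hgen
  have hnil : ∀ g, IsNilpotent (restrictedTranslation V hV g - 1) := fun g =>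
    isNilpotent_restrictedTranslation_sub_one V hV (hU.isUnipotentElement g)
  refine ⟨group_isNilpotent_of_forall_isNilpotent_sub_one hinj hnil, V, hfin, ?_⟩
  obtain ⟨n, hn⟩ := exists_augmentationSpan_pow_eq_bot hnil
  have hlen : ∀ g, (restrictedTranslation V hV g - 1) ^ (n + 2) = 0 := fun g => by
    have := Submodule.pow_mem_pow _
      (sub_one_mem_augmentationSpan (ρ := restrictedTranslation V hV) g) n
    rw [hn, Submodule.mem_bot] at this
    rw [pow_add, this, zero_mul]
  choose pow hpow using fun g s =>
    exists_restrictedTranslation_eq_unipotentPow V hV (hU.isUnipotentElement g) (hlen g) s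
  exact ⟨⟨restrictedTranslation V hV, hinj, n + 2, by omega, hlen, pow, hpow⟩⟩

end LinearAlgebraicGroup

/-- A one-parameter subgroup cannot embed into a group with fewer elements than `L`. -/
theorem UnipotentRep.exists_scalarPow_mem_ker {L : Type u} [Field L] [CharZero L] {R : Type*}
    [Ring R] [Algebra L R] {G : Type*} [Group G] (D : UnipotentRep L R G) {H : Type v} [Group H]
    (hcard : Cardinal.lift.{u} (Cardinal.mk H) < Cardinal.lift.{v} (Cardinal.mk L))
    (φ : G →* H) (x : G) : ∃ s : L, s ≠ 0 ∧ D.scalarPow x s ∈ φ.ker := by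
  have hninj : ¬ Function.Injective fun s : L => φ (D.scalarPow x s) := fun hinj =>
    hcard.not_ge (Cardinal.lift_mk_le_lift_mk_of_injective hinj)
  simp only [Function.Injective] at hninj
  push Not at hninj
  obtain ⟨s, t, hst, hne⟩ := hninj
  refine ⟨s - t, sub_ne_zero.2 hne, ?_⟩
  rw [MonoidHom.mem_ker, D.scalarPow_sub, map_mul, map_inv, hst, mul_inv_cancel]

theorem theorem1p3 {L : Type u} [Field L] [CharZero L]
    {H : Type v} [Group H]
    (hcard : Cardinal.lift.{u} (Cardinal.mk H) < Cardinal.lift.{v} (Cardinal.mk L))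
    {A : Type w} [CommRing A] [HopfAlgebra L A] [Algebra.FiniteType L A]
    (hU : LinearAlgebraicGroup.IsUnipotent L A)
    (φ : LinearAlgebraicGroup.RationalPoints L A →* H) :
    ∀ a ∈ φ.range, ∀ b ∈ φ.range, a * b = b * a := by
  obtain ⟨hnil, V, hfin, ⟨D⟩⟩ := hU.exists_unipotentRep
  have hker : commutator (LinearAlgebraicGroup.RationalPoints L A) ≤ φ.ker :=
    D.commutator_le_of_exists_scalarPow_mem φ.ker (D.exists_scalarPow_mem_ker hcard φ)
  rintro _ ⟨x, rfl⟩ _ ⟨y, rfl⟩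
  have hxy : φ ⁅x, y⁆ = 1 :=
    hker (Subgroup.commutator_mem_commutator (Subgroup.mem_top x) (Subgroup.mem_top y))
  rwa [map_commutatorElement, commutatorElement_eq_one_iff_mul_comm] at hxy
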